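/- Let $T\in(0,\infty]$ and let $(\Omega,\mathcal F,(\mathcal F_t)_{t\in[0,T]},P)$ be a complete filtered probability space satisfying the usual conditions. Let $h:\Omega\times[0,T]\times\mathbb R^d\to[-\infty,\infty]$ be an optional convex normal integrand: the epigraphs $\{(x,\alpha)\in\mathbb R^d\times\mathbb R: h_t(x,\omega)\le\alpha\}$ are closed and convex, and for every open $O\subseteq\mathbb R^d\times\mathbb R$ the set of $(\omega,t)$ at which the epigraph meets $O$ is optional. Let $S_t(\omega)=\operatorname{cl}\{x: h_t(x,\omega)<\infty\}$. For $\omega\in\Omega$ let $D(S)(\omega)$ be the set of all càdlàg functions $y:[0,T]\to\mathbb R^d$ (right-continuous, with left limits on $(0,T]$) such that $y_t\in S_t(\omega)$ for all $t\in[0,T]$. With the convention $y_{0-}:=0$, let $$\tilde S_t(\omega)=\operatorname{cl}\{y_{t-}: y\in D(S)(\omega)\},\qquad \vec S_0(\omega)=\{0\},\qquad \vec S_t(\omega)=\liminf_{s\uparrow t,\,s<t}S_s(\omega)\quad(t>0),$$ where $\liminf$ and $\limsup$ of sets are the Painlevé–Kuratowski inner and outer limits. A mapping $\Gamma:[0,T]\rightrightarrows\mathbb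 R^d$ is right-inner semicontinuous if $\{t:\Gamma_t\cap O\neq\emptyset\}$ is open in the topology $\tau_r$ generated by the intervals $[s,t)$, for every open $O$. It is càdlàg if it is right-inner semicontinuous, its graph is closed in the product of $\tau_r$ and the usual topology, and $\liminf_{s\uparrow t,\,s<t}\Gamma_s=\limsup_{s\uparrow t,\,s<t}\Gamma_s$ for all $t>0$. Assume that one of the following holds: 1. for every $\omega$, $S(\omega)$ is càdlàg, $S_t(\omega)\ne\emptyset$ for all $t\in[0,T]$ and $\vec S_t(\omega)\neq\emptyset$ for all $t\in(0,T]$; 2. for every $\omega$, $S(\omega)$ and $\vec S(\omega)$ are solid, that is, $S_t(\omega)$ has nonempty interior for all $t\in[0,T]$ and $\vec S_t(\omega)$ has nonempty interior for all $t\in(0,T]$; moreover, $S(\omega)$ is right-inner semicontinuous or, more generally, $D(S)(\omega)\neq\emptyset$. Then $\tilde S_t(\omega)=\vec S_t(\omega)$ for all $(\omega,t)\in\Omega\times[0,T]$, and $\tilde S$ is predictable: $\{(\omega,t):\tilde S_t(\omega)\cap O\ne\emptyset\}$ is a predictable set for every open $O\subseteq\mathbb R^d$. -/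

import Mathlib

open MeasureTheory Set Filter Topology
open scoped ENNReal

namespace CadlagSelections

/-- The time interval `[0, T]`, where `T = ∞` is allowed (then it is the compact interval
`[0, ∞]`); its least element `⊥` is time `0`. -/
abbrev TimeInterval (T : ℝ≥0∞) : Type := Set.Iic T

/-- The Euclidean space `ℝ^d`. -/
abbrev Vec (d : ℕ) : Type := EuclideanSpace ℝ (Fin d)

section Deterministic

variable {T : ℝ≥0∞}

/-- Càdlàg functions on `[0, T]`: right-continuous, with limits from the left. -/
def IsCadlag {X : Type*} [TopologicalSpace X] (y : TimeInterval T → X) : Prop :=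
  (∀ t, ContinuousWithinAt y (Set.Ici t) t) ∧
    ∀ t, ⊥ < t → ∃ l : X, Tendsto y (𝓝[<] t) (𝓝 l)

variable {d : ℕ}

/-- The left limits `y_{t-}` of a càdlàg function, with the convention `y_{0-} = 0`. -/
noncomputable def leftValue (y : TimeInterval T → Vec d) (t : TimeInterval T) : Vec d :=
  if t = ⊥ then 0 else Function.leftLim y t

/-- `D(Γ)`: the càdlàg selections of a set-valued mapping `Γ`. -/
def cadlagSelections (Γ : TimeInterval T → Set (Vec d)) : Set (TimeInterval T → Vec d) :=
  {y | IsCadlag y ∧ ∀ t, y t ∈ Γ t}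

/-- `t ↦ cl {y_{t-} | y ∈ D(Γ)}`. -/
noncomputable def tildeMap (Γ : TimeInterval T → Set (Vec d)) (t : TimeInterval T) :
    Set (Vec d) :=
  closure ((fun y => leftValue y t) '' cadlagSelections Γ)

/-- The inner limit (Painlevé–Kuratowski) of `Γ s` as `s` increases strictly to `t`:
the points `x` such that for every sequence `s_n` increasing strictly to `t` there are
`x_n ∈ Γ (s_n)`, for large `n`, with `x_n → x`. -/
def leftLiminf (Γ : TimeInterval T → Set (Vec d)) (t : TimeInterval T) : Set (Vec d) :=
  {x | ∀ U ∈ 𝓝 x, ∀ᶠ s in 𝓝[<] t, (Γ s ∩ U).Nonempty}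

/-- The outer limit (Painlevé–Kuratowski) of `Γ s` as `s` increases strictly to `t`:
the points `x` such that for some sequence `s_n` increasing strictly to `t` there are
`x_n ∈ Γ (s_n)` with `x_n → x`. -/
def leftLimsup (Γ : TimeInterval T → Set (Vec d)) (t : TimeInterval T) : Set (Vec d) :=
  {x | ∀ U ∈ 𝓝 x, ∃ᶠ s in 𝓝[<] t, (Γ s ∩ U).Nonempty}

/-- The mapping `Γ⃗`: `{0}` at time `0` and the left inner limit of `Γ` at times `t > 0`. -/
noncomputable def vecMap (Γ : TimeInterval T → Set (Vec d)) (t : TimeInterval T) :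
    Set (Vec d) :=
  if t = ⊥ then {0} else leftLiminf Γ t

/-- Right-inner semicontinuity: preimages of open sets are open in the topology generated by
the right-open intervals, whose neighbourhood filter at `t` is `𝓝[≥] t`. -/
def IsRightIsc (Γ : TimeInterval T → Set (Vec d)) : Prop :=
  ∀ O : Set (Vec d), IsOpen O → ∀ t, (Γ t ∩ O).Nonempty → ∀ᶠ s in 𝓝[≥] t, (Γ s ∩ O).Nonempty

/-- Right-outer semicontinuity: the graph is closed in the product of the topology generated by
the right-open intervals and the usual topology. -/
def IsRightOsc (Γ : TimeInterval T → Set (Vec d)) : Prop :=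
  ∀ t x, x ∉ Γ t → ∀ᶠ p in 𝓝[≥] t ×ˢ 𝓝 x, p.2 ∉ Γ p.1

/-- The mapping `Γ` has limits from the left. -/
def HasLeftLimits (Γ : TimeInterval T → Set (Vec d)) : Prop :=
  ∀ t, ⊥ < t → leftLiminf Γ t = leftLimsup Γ t

/-- Càdlàg set-valued mappings: right-continuous, with limits from the left. -/
structure IsCadlagMap (Γ : TimeInterval T → Set (Vec d)) : Prop where
  rightIsc : IsRightIsc Γ
  rightOsc : IsRightOsc Γ
  leftLimits : HasLeftLimits Γ

/-- `Γ` is solid at the times in `I`: its values there are convex with nonempty interior. -/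
def IsSolidOn (Γ : TimeInterval T → Set (Vec d)) (I : Set (TimeInterval T)) : Prop :=
  ∀ t ∈ I, Convex ℝ (Γ t) ∧ (interior (Γ t)).Nonempty

end Deterministic

section Measurability

/-- A set-valued mapping is measurable with respect to the σ-algebra `𝒜` if the inverse image
of every open set is in `𝒜`. -/
def IsMeasurableMap {Ξ X : Type*} [TopologicalSpace X] (𝒜 : MeasurableSpace Ξ)
    (Γ : Ξ → Set X) : Prop :=
  ∀ O : Set X, IsOpen O → MeasurableSet[𝒜] {ξ | (Γ ξ ∩ O).Nonempty}

/-- The epigraph of `h ξ`. -/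
def epi {Ξ X : Type*} (h : Ξ → X → EReal) (ξ : Ξ) : Set (X × ℝ) :=
  {p | h ξ p.1 ≤ (p.2 : EReal)}

/-- Convex normal integrands on `ℝ^d`, with respect to the σ-algebra `𝒜`: the epigraphical
mapping is closed convex-valued and measurable. -/
structure IsConvexNormalIntegrand {Ξ : Type*} {d : ℕ} (𝒜 : MeasurableSpace Ξ)
    (h : Ξ → Vec d → EReal) : Prop where
  closed : ∀ ξ, IsClosed (epi h ξ)
  convex : ∀ ξ, Convex ℝ (epi h ξ)
  measurable : IsMeasurableMap 𝒜 (epi h)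

/-- The image closure `ξ ↦ cl dom h ξ` of the domain mapping. -/
def closureDom {Ξ : Type*} {d : ℕ} (h : Ξ → Vec d → EReal) (ξ : Ξ) : Set (Vec d) :=
  closure {x | h ξ x < ⊤}

variable {Ω : Type*} {mΩ : MeasurableSpace Ω} {T : ℝ≥0∞}

/-- The usual conditions: the filtration is right-continuous, and its σ-algebra at time `0`
contains every set of outer measure zero (in particular the measure is complete). -/
structure UsualConditions (P : Measure Ω) (𝓕 : Filtration (TimeInterval T) mΩ) : Prop where
  rightContinuous : 𝓕.IsRightContinuous
  complete : ∀ N : Set Ω, P N = 0 → MeasurableSet[𝓕 ⊥] N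

/-- The optional σ-algebra on `[0, T] × Ω`: the one generated by the real-valued adapted
processes with càdlàg paths. -/
@[reducible]
def optionalSigmaAlgebra (𝓕 : Filtration (TimeInterval T) mΩ) :
    MeasurableSpace (TimeInterval T × Ω) :=
  MeasurableSpace.generateFrom
    {A | ∃ X : TimeInterval T → Ω → ℝ, (∀ t, Measurable[𝓕 t] (X t)) ∧
      (∀ ω, IsCadlag fun t => X t ω) ∧
      ∃ B : Set ℝ, MeasurableSet B ∧ A = {p | X p.1 p.2 ∈ B}}

end Measurability

end CadlagSelections

/-! A left limit of a selection is a limit of points of `S s`, so it lies in the closed left inner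
limit; the work is in the converse and in predictability.

In the càdlàg case, the path of nearest points of `S s` to a fixed `x` is a càdlàg selection
(`tendsto_nearestPoint`). If `x` is in the left inner limit at `t`, its left limit at `t` is `x`
itself. In the solid case, convexity puts an interior point `x` of the left inner limit inside `S s`
for all `s` just before `t` (`exists_ball_subset_of_mem_interior_innerLimit`). A given selection can
thus be replaced by the constant `x` there, and interior points are dense in the left inner limit.

For predictability, the event that the left inner limit meets `O` is, at positive times, a countable
union of events "the path stays in an optional set `G` just before `t`". Leaving `G` during `(q, r]`
is an event of `𝓕 r`, because optional sets are progressive and measurable projection applies to the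
complete space. -/

namespace CadlagSelections

/-! ### Capacitability, analytic sets and measurable projection -/

section Projection

/-- A neighbourhood of the compact box `{σ | ∀ i, σ i ≤ n i}` of the Baire space contains one of the
boxes in which only finitely many coordinates are bounded. -/
theorem exists_box_subset_of_isOpen {n : ℕ → ℕ} {V : Set (ℕ → ℕ)} (hV : IsOpen V)
    (hn : {σ | ∀ i, σ i ≤ n i} ⊆ V) : ∃ k, {σ : ℕ → ℕ | ∀ i < k, σ i ≤ n i} ⊆ V := by
  by_contra! hcon
  choose σ hσ hσV using fun k => Set.not_subset.1 (hcon k)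
  have hL : IsCompact {σ : ℕ → ℕ | ∀ i, σ i ≤ n i} := by
    have := isCompact_univ_pi (fun i => (Set.finite_Iic (n i)).isCompact)
    convert this using 1
    ext τ
    simp [Pi.le_def]
  -- Zeroing the coordinates from `k` on moves `σ k` into the compact box; each fixed coordinate is
  -- eventually untouched, so `σ` has the same limit along `φ`.
  obtain ⟨τ, hτ, φ, hφ, hlim⟩ := hL.tendsto_subseq
    (x := fun k i => if i < k then σ k i else 0) fun k i => by
      by_cases hi : i < k
      · simpa [hi] using hσ k i hi
      · simp [hi]
  have hlim' : Tendsto (fun j => σ (φ j)) atTop (𝓝 τ) := by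
    rw [tendsto_pi_nhds] at hlim ⊢
    intro i
    refine (hlim i).congr' ?_
    filter_upwards [hφ.tendsto_atTop.eventually_gt_atTop i] with j hj
    simp [hj]
  obtain ⟨j, hj⟩ := (hlim'.eventually (hV.mem_nhds (hn hτ))).exists
  exact hσV _ hj

variable {X : Type*} [TopologicalSpace X] [MeasurableSpace X]

/-- Choquet's capacitability theorem for the outer measure of an analytic set. -/
theorem exists_isCompact_subset_range_le_measure (μ : Measure X) [μ.OuterRegular]
    {f : (ℕ → ℕ) → X} (hf : Continuous f) {r : ℝ≥0∞} (hr : r < μ (range f)) :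
    ∃ K ⊆ range f, IsCompact K ∧ r ≤ μ K := by
  have step : ∀ (k : ℕ) (B : Set (ℕ → ℕ)), r < μ (f '' B) →
      ∃ m, r < μ (f '' (B ∩ {σ | σ k ≤ m})) := by
    intro k B hB
    have hmono : Monotone fun m => f '' (B ∩ {σ | σ k ≤ m}) := fun a b hab =>
      image_mono (inter_subset_inter_right _ fun σ hσ => le_trans hσ hab)
    have hU : ⋃ m, f '' (B ∩ {σ | σ k ≤ m}) = f '' B := by
      rw [← image_iUnion, ← inter_iUnion]
      congr 1
      exact inter_eq_left.2 fun σ _ => mem_iUnion.2 ⟨σ k, le_refl (σ k)⟩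
    -- Continuity from below holds for the outer measure, so the images need not be measurable.
    rw [← hU, hmono.measure_iUnion] at hB
    exact lt_iSup_iff.1 hB
  choose! m hm using step
  let B : ℕ → Set (ℕ → ℕ) := fun k => Nat.rec univ (fun k B => B ∩ {σ | σ k ≤ m k B}) k
  have hBs : ∀ k, B (k + 1) = B k ∩ {σ | σ k ≤ m k (B k)} := fun k => rfl
  have hB : ∀ k, r < μ (f '' B k) := by
    intro k
    induction k with
    | zero => simpa [B] using hr
    | succ k ih => rw [hBs]; exact hm k _ ih
  have hBeq : ∀ k, B k = {σ | ∀ i < k, σ i ≤ m i (B i)} := by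
    intro k
    induction k with
    | zero => simp [B]
    | succ k ih =>
      rw [hBs]
      ext σ
      rw [mem_inter_iff, Set.ext_iff.1 ih σ]
      simp only [mem_ofPred_eq, Nat.lt_succ_iff_lt_or_eq]
      constructor
      · rintro ⟨h1, h2⟩ i (hi | rfl)
        exacts [h1 i hi, h2]
      · exact fun h => ⟨fun i hi => h i (Or.inl hi), h k (Or.inr rfl)⟩
  have hL : IsCompact {σ : ℕ → ℕ | ∀ i, σ i ≤ m i (B i)} := by
    have := isCompact_univ_pi (fun i => (Set.finite_Iic (m i (B i))).isCompact)
    convert this using 1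
    ext τ
    simp [Pi.le_def]
  refine ⟨_, image_subset_range f _, hL.image hf, ?_⟩
  -- Otherwise outer regularity gives an open `U` around the compact image with measure below `r`;
  -- its preimage contains some `B k`, whose image has measure above `r`.
  by_contra! hlt
  obtain ⟨U, hLU, hU, hUr⟩ := Set.exists_isOpen_lt_of_lt _ r hlt
  obtain ⟨k, hk⟩ := exists_box_subset_of_isOpen (hU.preimage hf) (image_subset_iff.1 hLU)
  rw [← hBeq] at hk
  exact absurd ((hB k).trans_le (measure_mono (image_subset_iff.2 hk))) hUr.not_gt

/-- Analytic sets are universally measurable. -/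
theorem nullMeasurableSet_of_analyticSet [T2Space X] [OpensMeasurableSpace X] (μ : Measure X)
    [IsFiniteMeasure μ] [μ.OuterRegular] {s : Set X} (hs : AnalyticSet s) : NullMeasurableSet s μ := by
  rw [AnalyticSet] at hs
  obtain rfl | ⟨f, hf, rfl⟩ := hs
  · exact nullMeasurableSet_empty
  rcases eq_or_ne (μ (range f)) 0 with h0 | h0
  · exact NullMeasurableSet.of_null h0
  obtain ⟨u, -, hu, hlim⟩ := exists_seq_strictMono_tendsto' (pos_iff_ne_zero.2 h0)
  choose K hKs hK hKu using fun n =>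
    exists_isCompact_subset_range_le_measure μ hf (hu n).2
  have hm : MeasurableSet (⋃ n, K n) := .iUnion fun n => (hK n).measurableSet
  refine hm.nullMeasurableSet.congr
    (ae_eq_of_subset_of_measure_ge (iUnion_subset hKs) ?_ hm.nullMeasurableSet
      (measure_ne_top _ _))
  exact le_of_tendsto' hlim fun n => (hKu n).trans (measure_mono (subset_iUnion K n))

/-- A measurable subset of a product is the preimage of a measurable set under a measurable map
of the second factor to the Cantor space. -/
theorem exists_measurable_cantor_of_measurableSet_prod {K Ω : Type*} [MeasurableSpace K]
    [MeasurableSpace Ω] {A : Set (K × Ω)} (hA : MeasurableSet A) :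
    ∃ φ : Ω → ℕ → Bool, Measurable φ ∧ ∃ A' : Set (K × (ℕ → Bool)), MeasurableSet A' ∧
      A = Prod.map id φ ⁻¹' A' := by
  rw [← generateFrom_prod] at hA
  induction A, hA using MeasurableSpace.generateFrom_induction with
  | hC A hA _ =>
    obtain ⟨C, hC, F, hF, rfl⟩ := hA
    classical
    refine ⟨fun ω _ => decide (ω ∈ F), measurable_pi_lambda _ fun _ => ?_,
      C ×ˢ ((fun σ : ℕ → Bool => σ 0) ⁻¹' {true}),
      hC.prod (measurable_pi_apply 0 (measurableSet_singleton true)), ?_⟩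
    · exact measurable_to_bool (by simpa [preimage] using hF)
    · ext p
      simp
  | empty => exact ⟨fun _ _ => true, measurable_const, ∅, .empty, rfl⟩
  | compl A _ ih =>
    obtain ⟨φ, hφ, A', hA', rfl⟩ := ih
    exact ⟨φ, hφ, A'ᶜ, hA'.compl, rfl⟩
  | iUnion A _ ih =>
    choose φ hφ A' hA' h using ih
    -- Countably many Cantor codes are interleaved into a single one.
    refine ⟨fun ω k => φ k.unpair.1 ω k.unpair.2, measurable_pi_lambda _ fun k =>
      (measurable_pi_apply _).comp (hφ _),
      ⋃ n, Prod.map id (fun σ k => σ (Nat.pair n k)) ⁻¹' A' n, .iUnion fun n => ?_, ?_⟩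
    · exact (measurable_id.prodMap
        (measurable_pi_lambda _ fun k => measurable_pi_apply _)) (hA' n)
    · rw [preimage_iUnion]
      refine iUnion_congr fun n => ?_
      rw [h n, ← preimage_comp]
      congr 1
      ext p <;> simp

/-- The measurable projection theorem. -/
theorem measurableSet_image_snd_of_isComplete {K Ω : Type*} [MeasurableSpace K]
    [StandardBorelSpace K] [MeasurableSpace Ω] (P : Measure Ω) [IsFiniteMeasure P]
    [P.IsComplete] {A : Set (K × Ω)} (hA : MeasurableSet A) : MeasurableSet (Prod.snd '' A) := by
  obtain ⟨φ, hφ, A', hA', rfl⟩ := exists_measurable_cantor_of_measurableSet_prod hA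
  have himg : Prod.snd '' (Prod.map id φ ⁻¹' A' : Set (K × Ω)) = φ ⁻¹' (Prod.snd '' A') := by
    ext ω
    simp
  rw [himg]
  -- Over the Cantor space the projection is analytic, hence null-measurable for the law of `φ`;
  -- completeness of `P` makes its preimage measurable.
  have han : AnalyticSet (Prod.snd '' A') := hA'.analyticSet_image measurable_snd
  exact ((nullMeasurableSet_of_analyticSet (P.map φ) han).preimage
    (hφ.quasiMeasurePreserving P)).measurable_of_complete

end Projection

end CadlagSelections

namespace CadlagSelections

/-! ### Progressive measurability and hitting events of optional sets -/

section Optional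

variable {T : ℝ≥0∞}

instance : PolishSpace (TimeInterval T) := isClosed_Iic.polishSpace

/-- The smallest element of `{u 0, …, u (n - 1), r}` above `s`, for `s ≤ r`. -/
noncomputable def timeApprox (u : ℕ → TimeInterval T) (r : TimeInterval T) :
    ℕ → TimeInterval T → TimeInterval T
  | 0, _ => r
  | n + 1, s => if s ≤ u n ∧ u n ≤ timeApprox u r n s then u n else timeApprox u r n s

theorem timeApprox_le (u : ℕ → TimeInterval T) (r : TimeInterval T) (n : ℕ) (s : TimeInterval T) :
    timeApprox u r n s ≤ r := by
  induction n with
  | zero => exact le_rfl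
  | succ n ih =>
    rw [timeApprox]
    split_ifs with h
    exacts [h.2.trans ih, ih]

theorem min_le_timeApprox (u : ℕ → TimeInterval T) (r : TimeInterval T) (n : ℕ)
    (s : TimeInterval T) : min s r ≤ timeApprox u r n s := by
  induction n with
  | zero => exact min_le_right _ _
  | succ n ih =>
    rw [timeApprox]
    split_ifs with h
    exacts [(min_le_left _ _).trans h.1, ih]

theorem timeApprox_le_of_lt (u : ℕ → TimeInterval T) (r : TimeInterval T) {k : ℕ}
    {s : TimeInterval T} (hk : s ≤ u k) {n : ℕ} (hn : k < n) : timeApprox u r n s ≤ u k := by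
  induction n, hn using Nat.le_induction with
  | base =>
    rw [timeApprox]
    split_ifs with h
    · exact le_rfl
    · exact (not_le.1 fun h' => h ⟨hk, h'⟩).le
  | succ n _ ih =>
    rw [timeApprox]
    split_ifs with h
    exacts [h.2.trans ih, ih]

/-- The approximants never fall below the limit, so right-continuity of a path at `min s r` suffices
to pass to the limit. -/
theorem tendsto_timeApprox {u : ℕ → TimeInterval T} (hu : DenseRange u) (r s : TimeInterval T) :
    Tendsto (fun n => timeApprox u r n s) atTop (𝓝[≥] (min s r)) := by
  refine tendsto_nhdsWithin_iff.2 ⟨tendsto_order.2 ⟨fun a ha => ?_, fun b hb => ?_⟩,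
    .of_forall fun n => min_le_timeApprox u r n s⟩
  · exact .of_forall fun n => ha.trans_le (min_le_timeApprox u r n s)
  · by_cases hbr : r < b
    · exact .of_forall fun n => (timeApprox_le u r n s).trans_lt hbr
    · have hsb : s < b := by
        rcases min_lt_iff.1 hb with h | h
        exacts [h, absurd h hbr]
      obtain ⟨k, hk⟩ := hu.exists_mem_open isOpen_Ioo (nonempty_Ioo.2 hsb)
      filter_upwards [eventually_gt_atTop k] with n hn
      exact (timeApprox_le_of_lt u r hk.1.le hn).trans_lt hk.2

theorem measurable_timeApprox (u : ℕ → TimeInterval T) (r : TimeInterval T) (n : ℕ) :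
    Measurable (timeApprox u r n) := by
  induction n with
  | zero => exact measurable_const
  | succ n ih =>
    exact Measurable.ite
      (measurableSet_Iic.inter (ih measurableSet_Ici)) measurable_const ih

variable {Ω : Type*} {mΩ : MeasurableSpace Ω} (𝓕 : Filtration (TimeInterval T) mΩ)

/-- Adapted processes with right-continuous paths are progressively measurable. -/
theorem measurable_stopped_of_rightContinuous {X : TimeInterval T → Ω → ℝ}
    (hX : ∀ t, Measurable[𝓕 t] (X t))
    (hc : ∀ ω t, ContinuousWithinAt (fun s => X s ω) (Ici t) t) (r : TimeInterval T) :
    Measurable[Subtype.instMeasurableSpace.prod (𝓕 r)]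
      (fun p : TimeInterval T × Ω => X (min p.1 r) p.2) := by
  let _ : MeasurableSpace Ω := 𝓕 r
  obtain ⟨u, hu⟩ := TopologicalSpace.exists_dense_seq (TimeInterval T)
  refine measurable_of_tendsto_metrizable
    (f := fun n (p : TimeInterval T × Ω) => X (timeApprox u r n p.1) p.2) (fun n => ?_) ?_
  · have hXm : ∀ v ≤ r, Measurable (X v) := fun v hv => (hX v).mono (𝓕.mono hv) le_rfl
    induction n with
    | zero => exact (hXm r le_rfl).comp measurable_snd
    | succ n ih =>
      by_cases hur : u n ≤ r
      · have : (fun p : TimeInterval T × Ω => X (timeApprox u r (n + 1) p.1) p.2) = fun p =>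
            if p.1 ≤ u n ∧ u n ≤ timeApprox u r n p.1 then X (u n) p.2
            else X (timeApprox u r n p.1) p.2 := by
          ext p
          rw [timeApprox]
          split_ifs <;> rfl
        rw [this]
        exact Measurable.ite (measurable_fst (measurableSet_Iic.inter
          (measurable_timeApprox u r n measurableSet_Ici)))
          ((hXm _ hur).comp measurable_snd) ih
      -- A time `u n` beyond `r` is never selected, so only variables known at time `r` are used.
      · have : ∀ s, timeApprox u r (n + 1) s = timeApprox u r n s := fun s =>
          if_neg fun h => hur (h.2.trans (timeApprox_le u r n s))
        simpa only [this] using ih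
  · exact tendsto_pi_nhds.2 fun p => (hc p.2 (min p.1 r)).tendsto.comp (tendsto_timeApprox hu r p.1)

/-- Optional sets are progressively measurable. -/
theorem measurable_min_of_optional (r : TimeInterval T) :
    Measurable[Subtype.instMeasurableSpace.prod (𝓕 r), optionalSigmaAlgebra 𝓕]
      (fun p : TimeInterval T × Ω => (min p.1 r, p.2)) := by
  let _ : MeasurableSpace Ω := 𝓕 r
  refine @measurable_generateFrom _ _ _ _ _ ?_
  rintro _ ⟨X, hX, hc, B, hB, rfl⟩
  exact measurable_stopped_of_rightContinuous 𝓕 hX (fun ω => (hc ω).1) r hB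

variable {P : Measure Ω} [IsFiniteMeasure P]

/-- The projection of an optional set restricted to `(q, r]` is known at time `r`. -/
theorem measurableSet_exists_mem_Ioc_of_optional (h𝓕 : UsualConditions P 𝓕)
    {G : Set (TimeInterval T × Ω)} (hG : MeasurableSet[optionalSigmaAlgebra 𝓕] G)
    (q r : TimeInterval T) : MeasurableSet[𝓕 r] {ω | ∃ s ∈ Ioc q r, (s, ω) ∈ G} := by
  -- All null sets are already in `𝓕 ⊥`, so projection can be carried out within `𝓕 r`.
  have hcomp : (P.trim (𝓕.le r)).IsComplete := ⟨fun s hs =>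
    𝓕.mono bot_le _ (h𝓕.complete s (measure_eq_zero_of_trim_eq_zero (𝓕.le r) hs))⟩
  have hm := measurable_min_of_optional 𝓕 r hG
  let _ : MeasurableSpace Ω := 𝓕 r
  have := measurableSet_image_snd_of_isComplete (P.trim (𝓕.le r))
    (hm.inter (measurable_fst (measurableSet_Ioc (a := q) (b := r))))
  convert this using 1
  ext ω
  simp only [mem_ofPred_eq, mem_image, mem_inter_iff, mem_preimage, Prod.exists,
    exists_eq_right]
  refine exists_congr fun s => ⟨fun h => ⟨?_, h.1⟩, fun h => ⟨h.2, ?_⟩⟩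
  · simpa only [min_eq_left h.1.2] using h.2
  · simpa only [min_eq_left h.2.2] using h.1

/-- The times up to which a path has stayed in an optional set since time `q` form a predictable
set. -/
theorem measurableSet_predictable_forall_mem_Ioo (h𝓕 : UsualConditions P 𝓕)
    {G : Set (TimeInterval T × Ω)} (hG : MeasurableSet[optionalSigmaAlgebra 𝓕] G)
    (q : TimeInterval T) :
    MeasurableSet[𝓕.predictable]
      {p : TimeInterval T × Ω | q < p.1 ∧ ∀ s ∈ Ioo q p.1, (s, p.2) ∈ G} := by
  obtain ⟨D, hDc, hD⟩ := TopologicalSpace.exists_countable_dense (TimeInterval T)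
  -- A path outside `G` somewhere in `(q, t)` is so in `(q, r]` for some `r < t` in `D`, which
  -- leaves countably many predictable rectangles to remove.
  have key : {p : TimeInterval T × Ω | q < p.1 ∧ ∀ s ∈ Ioo q p.1, (s, p.2) ∈ G} =
      (Ioi q ×ˢ univ) \ ⋃ r ∈ D, Ioi r ×ˢ {ω | ∃ s ∈ Ioc q r, (s, ω) ∈ Gᶜ} := by
    ext ⟨t, ω⟩
    simp only [mem_ofPred_eq, Set.mem_sdiff, mem_prod, mem_univ, and_true, mem_Ioi, mem_iUnion,
      exists_prop, not_exists, not_and]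
    refine and_congr_right fun _ => ⟨?_, ?_⟩
    · intro h r _ hrt s hs hsG
      exact hsG (h s ⟨hs.1, hs.2.trans_lt hrt⟩)
    · intro h s hs
      by_contra hsG
      obtain ⟨r, hrD, hr⟩ := hD.exists_mem_open isOpen_Ioo (nonempty_Ioo.2 hs.2)
      exact h r hrD hr.2 s ⟨hs.1, hr.1.le⟩ hsG
  rw [key]
  refine MeasurableSet.diff (measurableSet_predictable_Ioi_prod .univ)
    (.biUnion hDc fun r _ => measurableSet_predictable_Ioi_prod ?_)
  exact measurableSet_exists_mem_Ioc_of_optional 𝓕 h𝓕 hG.compl q r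

end Optional

end CadlagSelections

namespace CadlagSelections

/-! ### Painlevé–Kuratowski limits of convex sets and nearest points -/

section SetLimits

variable {ι : Type*} {E : Type*}

/-- The Painlevé–Kuratowski inner limit of `A` along the filter `l`. -/
def innerLimit [TopologicalSpace E] (l : Filter ι) (A : ι → Set E) : Set E :=
  {x | ∀ U ∈ 𝓝 x, ∀ᶠ s in l, (A s ∩ U).Nonempty}

/-- The Painlevé–Kuratowski outer limit of `A` along the filter `l`. -/
def outerLimit [TopologicalSpace E] (l : Filter ι) (A : ι → Set E) : Set E :=
  {x | ∀ U ∈ 𝓝 x, ∃ᶠ s in l, (A s ∩ U).Nonempty}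

theorem isClosed_innerLimit [TopologicalSpace E] (l : Filter ι) (A : ι → Set E) :
    IsClosed (innerLimit l A) := by
  refine isClosed_of_closure_subset fun x hx U hU => ?_
  obtain ⟨y, hyU, hy⟩ := mem_closure_iff.1 hx _ isOpen_interior (mem_interior_iff_mem_nhds.2 hU)
  filter_upwards [hy _ (isOpen_interior.mem_nhds hyU)] with s hs
  exact hs.mono (inter_subset_inter_right _ interior_subset)

theorem mem_innerLimit_iff [PseudoMetricSpace E] {l : Filter ι} {A : ι → Set E} {x : E} :
    x ∈ innerLimit l A ↔ ∀ ε > 0, ∀ᶠ s in l, ∃ y ∈ A s, dist y x < ε :=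
  ⟨fun h ε hε => (h _ (Metric.ball_mem_nhds x hε)).mono fun _ ⟨y, hy, hyx⟩ => ⟨y, hy, hyx⟩,
    fun h U hU => by
      obtain ⟨ε, hε, hεU⟩ := Metric.mem_nhds_iff.1 hU
      exact (h ε hε).mono fun s ⟨y, hy, hyx⟩ => ⟨y, hy, hεU hyx⟩⟩

/-- A compact set that is frequently met by `A` meets the outer limit of `A`. -/
theorem nonempty_outerLimit_inter [TopologicalSpace E] {l : Filter ι} {A : ι → Set E} {K : Set E}
    (hK : IsCompact K) (h : ∃ᶠ s in l, (A s ∩ K).Nonempty) : (outerLimit l A ∩ K).Nonempty := by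
  by_contra hne
  have : ∀ x ∈ K, ∃ U ∈ 𝓝[K] x, ∀ᶠ s in l, ¬ (A s ∩ U).Nonempty := by
    intro x hx
    have hx' : x ∉ outerLimit l A := fun hx' => hne ⟨x, hx', hx⟩
    simp only [outerLimit, mem_ofPred_eq, not_forall, not_frequently] at hx'
    obtain ⟨U, hU, hUl⟩ := hx'
    exact ⟨U, mem_nhdsWithin_of_mem_nhds hU, hUl⟩
  refine h (hK.induction_on (p := fun U => ∀ᶠ s in l, ¬ (A s ∩ U).Nonempty) ?_ ?_ ?_ this)
  · simp
  · exact fun U V hUV hV => hV.mono fun s hs hs' => hs (hs'.mono (inter_subset_inter_right _ hUV))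
  · intro U V hU hV
    filter_upwards [hU, hV] with s h1 h2
    rw [inter_union_distrib_left, union_nonempty]
    exact not_or.2 ⟨h1, h2⟩

theorem convex_innerLimit [SeminormedAddCommGroup E] [NormedSpace ℝ E] {l : Filter ι}
    {A : ι → Set E} (hA : ∀ s, Convex ℝ (A s)) : Convex ℝ (innerLimit l A) := by
  intro x hx y hy a b ha hb hab
  rw [mem_innerLimit_iff] at hx hy ⊢
  intro ε hε
  filter_upwards [hx ε hε, hy ε hε] with s ⟨u, hu, hux⟩ ⟨v, hv, hvy⟩
  refine ⟨a • u + b • v, hA s hu hv ha hb hab, ?_⟩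
  have hball := convex_ball (0 : E) ε (x := u - x) (by simpa [dist_eq_norm] using hux)
    (y := v - y) (by simpa [dist_eq_norm] using hvy) ha hb hab
  rw [dist_eq_norm]
  have e : a • u + b • v - (a • x + b • y) = a • (u - x) + b • (v - y) := by
    rw [smul_sub, smul_sub]
    abel
  rw [e]
  exact mem_ball_zero_iff.1 hball

variable [NormedAddCommGroup E] [InnerProductSpace ℝ E]

/-- If the points of a finite family are moved by less than `r`, their convex hull keeps the points
whose closed `2r`-ball it contained. -/
theorem ball_subset_convexHull_of_dist_lt [CompleteSpace E] {κ : Type*} [Finite κ] {v w : κ → E}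
    {x : E} {r : ℝ} (hr : 0 < r) (hv : Metric.closedBall x (2 * r) ⊆ convexHull ℝ (range v))
    (hvw : ∀ i, dist (w i) (v i) < r) : Metric.ball x r ⊆ convexHull ℝ (range w) := by
  intro z hz
  by_contra hzw
  obtain ⟨f, c, hfw, hfz⟩ := geometric_hahn_banach_closed_point (convex_convexHull ℝ (range w))
    ((finite_range w).isCompact_convexHull (𝕜 := ℝ)).isClosed hzw
  obtain ⟨a, rfl⟩ := (InnerProductSpace.toDual ℝ E).surjective f
  simp only [InnerProductSpace.toDual_apply_apply] at hfw hfz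
  have hwz : ∀ i, inner ℝ a (w i) < inner ℝ a z := fun i =>
    (hfw _ (subset_convexHull ℝ _ (mem_range_self i))).trans hfz
  have hx : x ∈ convexHull ℝ (range v) := hv (Metric.mem_closedBall_self (by positivity))
  have ha : a ≠ 0 := by
    rintro rfl
    obtain ⟨_, i, rfl⟩ := convexHull_nonempty_iff.1 ⟨x, hx⟩
    simpa using hwz i
  have hna : 0 < ‖a‖ := norm_pos_iff.2 ha
  have hvz : convexHull ℝ (range v) ⊆ {y | inner ℝ a y ≤ inner ℝ a z + ‖a‖ * r} := by
    refine convexHull_min ?_ (convex_halfSpace_le (innerₛₗ ℝ a).isLinear _)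
    rintro _ ⟨i, rfl⟩
    have h1 : inner ℝ a (v i - w i) ≤ ‖a‖ * r := (real_inner_le_norm _ _).trans
      (mul_le_mul_of_nonneg_left (by rw [← dist_eq_norm, dist_comm]; exact (hvw i).le) hna.le)
    rw [inner_sub_right] at h1
    simp only [mem_ofPred_eq]
    linarith [hwz i]
  -- The point of the `2r`-ball farthest in direction `a` forces `⟪a, z - x⟫ ≥ ‖a‖ r`, too much for
  -- `z` in the open `r`-ball.
  have hy := hvz (hv (show x + (2 * r / ‖a‖) • a ∈ Metric.closedBall x (2 * r) by
    rw [Metric.mem_closedBall, dist_eq_norm, add_sub_cancel_left, norm_smul, Real.norm_eq_abs,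
      abs_of_pos (by positivity), div_mul_cancel₀ _ hna.ne']))
  have h2 : inner ℝ a (z - x) < ‖a‖ * r := (real_inner_le_norm _ _).trans_lt
    (mul_lt_mul_of_pos_left (by rw [← dist_eq_norm]; exact hz) hna)
  rw [inner_sub_right] at h2
  simp only [mem_ofPred_eq, inner_add_right, inner_smul_right, real_inner_self_eq_norm_sq] at hy
  have h3 : 2 * r / ‖a‖ * ‖a‖ ^ 2 = 2 * (‖a‖ * r) := by
    field_simp
  linarith

/-- The interior of the inner limit of convex sets is eventually absorbed by the sets. -/
theorem exists_ball_subset_of_mem_interior_innerLimit [FiniteDimensional ℝ E] {l : Filter ι}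
    {A : ι → Set E} (hA : ∀ s, Convex ℝ (A s)) {x : E} (hx : x ∈ interior (innerLimit l A)) :
    ∃ r > 0, ∀ᶠ s in l, Metric.ball x r ⊆ A s := by
  -- `x` is interior to a simplex with vertices in the inner limit. Being finitely many, these are
  -- eventually approximated simultaneously by points of `A s`.
  obtain ⟨b, hb, hbA⟩ := exists_mem_interior_convexHull_affineBasis (mem_interior_iff_mem_nhds.1 hx)
  obtain ⟨r, hr, hrb⟩ := Metric.nhds_basis_closedBall.mem_iff.1 (mem_interior_iff_mem_nhds.1 hb)
  refine ⟨r / 2, by positivity, ?_⟩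
  have : ∀ i, ∀ᶠ s in l, ∃ y ∈ A s, dist y (b i) < r / 2 := fun i =>
    mem_innerLimit_iff.1 (hbA (subset_convexHull ℝ _ (mem_range_self i))) _ (by positivity)
  filter_upwards [eventually_all.2 this] with s hs
  choose w hw hwb using hs
  refine (ball_subset_convexHull_of_dist_lt (by positivity) ?_ hwb).trans
    (convexHull_min (range_subset_iff.2 hw) (hA s))
  rwa [mul_div_cancel₀ _ two_ne_zero]

/-- In a closed convex set there is a unique nearest point, stated with distances. -/
theorem exists_forall_dist_le_of_convex [CompleteSpace E] {C : Set E} (hne : C.Nonempty)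
    (hC : IsClosed C) (hconv : Convex ℝ C) (x : E) :
    ∃ p ∈ C, (∀ z ∈ C, dist p x ≤ dist z x) ∧ ∀ z ∈ C, dist z x ≤ dist p x → z = p := by
  obtain ⟨p, hp, hpx⟩ := exists_norm_eq_iInf_of_complete_convex hne hC.isComplete hconv x
  have hin := (norm_eq_iInf_iff_real_inner_le_zero hconv hp).1 hpx
  have hsq : ∀ z ∈ C, dist p x ^ 2 + dist z p ^ 2 ≤ dist z x ^ 2 := by
    intro z hz
    have h := hin z hz
    have e : z - x = (z - p) - (x - p) := by abel
    rw [dist_eq_norm z x, e, norm_sub_sq_real, dist_comm p x, dist_eq_norm x p, dist_eq_norm z p,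
      real_inner_comm]
    linarith
  refine ⟨p, hp, fun z hz => ?_, fun z hz hzx => ?_⟩
  · exact (pow_le_pow_iff_left₀ dist_nonneg dist_nonneg two_ne_zero).1
      (by linarith [hsq z hz, sq_nonneg (dist z p)])
  · have h1 := hsq z hz
    have h2 := pow_le_pow_left₀ dist_nonneg hzx 2
    exact dist_eq_zero.1 (pow_eq_zero_iff two_ne_zero |>.1
      (le_antisymm (by linarith) (sq_nonneg _)))

open Classical in
/-- The nearest point of `C` to `x`, meaningful for nonempty closed convex sets `C`. -/
noncomputable def nearestPoint [CompleteSpace E] (C : Set E) (x : E) : E :=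
  if h : C.Nonempty ∧ IsClosed C ∧ Convex ℝ C then
    (exists_forall_dist_le_of_convex h.1 h.2.1 h.2.2 x).choose else x

theorem nearestPoint_spec [CompleteSpace E] {C : Set E} (hne : C.Nonempty)
    (hC : IsClosed C) (hconv : Convex ℝ C) (x : E) :
    nearestPoint C x ∈ C ∧ (∀ z ∈ C, dist (nearestPoint C x) x ≤ dist z x) ∧
      ∀ z ∈ C, dist z x ≤ dist (nearestPoint C x) x → z = nearestPoint C x := by
  rw [nearestPoint, dif_pos ⟨hne, hC, hconv⟩]
  exact (exists_forall_dist_le_of_convex hne hC hconv x).choose_spec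

/-- Nearest points depend continuously on the set, for Painlevé–Kuratowski convergence. -/
theorem tendsto_nearestPoint [FiniteDimensional ℝ E] {l : Filter ι} {A : ι → Set E} {C : Set E}
    (hne : ∀ s, (A s).Nonempty) (hA : ∀ s, IsClosed (A s)) (hconv : ∀ s, Convex ℝ (A s))
    (hCne : C.Nonempty) (hC : IsClosed C) (hCconv : Convex ℝ C)
    (hinner : C ⊆ innerLimit l A) (houter : outerLimit l A ⊆ C) (x : E) :
    Tendsto (fun s => nearestPoint (A s) x) l (𝓝 (nearestPoint C x)) := by
  have : ProperSpace E := FiniteDimensional.proper_real E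
  obtain ⟨hp, -, hpu⟩ := nearestPoint_spec hCne hC hCconv x
  set p := nearestPoint C x
  have hdist : ∀ ε > 0, ∀ᶠ s in l, dist (nearestPoint (A s) x) x < dist p x + ε := by
    intro ε hε
    filter_upwards [mem_innerLimit_iff.1 (hinner hp) ε hε] with s ⟨y, hy, hyp⟩
    have h1 := (nearestPoint_spec (hne s) (hA s) (hconv s) x).2.1 y hy
    linarith [dist_triangle y p x]
  refine Metric.tendsto_nhds.2 fun δ hδ => ?_
  by_contra hcon
  rw [not_eventually] at hcon
  -- If nearest points frequently stay `δ` away from `p`, compactness yields points of `C` that are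
  -- almost as near to `x` as `p` but `δ` away from it. The closest such point is as near as `p`,
  -- against uniqueness.
  have hfar : ∀ ε > 0, ∃ z ∈ C, dist z x ≤ dist p x + ε ∧ δ ≤ dist z p := by
    intro ε hε
    have hK : IsCompact (Metric.closedBall x (dist p x + ε) ∩ {z | δ ≤ dist z p}) :=
      (isCompact_closedBall _ _).inter_right
        (isClosed_le continuous_const (continuous_id.dist continuous_const))
    obtain ⟨z, hz, hzx, hzp⟩ := nonempty_outerLimit_inter (l := l) (A := A) hK
      ((hcon.and_eventually (hdist ε hε)).mono fun s hs => ⟨nearestPoint (A s) x,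
        (nearestPoint_spec (hne s) (hA s) (hconv s) x).1, hs.2.le, not_lt.1 hs.1⟩)
    exact ⟨z, houter hz, hzx, hzp⟩
  have hK : IsCompact (C ∩ Metric.closedBall x (dist p x + 1) ∩ {z | δ ≤ dist z p}) :=
    ((isCompact_closedBall _ _).inter_left hC).inter_right
      (isClosed_le continuous_const (continuous_id.dist continuous_const))
  obtain ⟨z₁, hz₁C, hz₁x, hz₁p⟩ := hfar 1 one_pos
  obtain ⟨z, ⟨⟨hzC, -⟩, hzp⟩, hzmin⟩ := hK.exists_isMinOn ⟨z₁, ⟨hz₁C, hz₁x⟩, hz₁p⟩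
    (f := fun z => dist z x) (by fun_prop)
  have hzx : dist z x ≤ dist p x := by
    refine le_of_forall_pos_le_add fun ε hε => ?_
    -- The cap `1` keeps `z'` in the compact set over which `z` minimises.
    obtain ⟨z', hz'C, hz'x, hz'p⟩ := hfar (min ε 1) (by positivity)
    exact (hzmin ⟨⟨hz'C, hz'x.trans (by gcongr; exact min_le_right _ _)⟩, hz'p⟩).trans
      (hz'x.trans (by gcongr; exact min_le_left _ _))
  rw [hpu z hzC hzx] at hzp
  simp only [mem_ofPred_eq, dist_self] at hzp
  exact hδ.not_ge hzp

end SetLimits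

end CadlagSelections

namespace CadlagSelections

/-! ### Càdlàg selections and their left limits -/

section Paths

variable {T : ℝ≥0∞} {d : ℕ}

theorem nhdsLT_neBot_of_bot_lt {t : TimeInterval T} (ht : ⊥ < t) : (𝓝[<] t).NeBot :=
  nhdsLT_neBot_of_exists_lt ⟨⊥, ht⟩

theorem isCadlag_const {X : Type*} [TopologicalSpace X] (x : X) :
    IsCadlag fun _ : TimeInterval T => x :=
  ⟨fun _ => continuousWithinAt_const, fun _ _ => ⟨x, tendsto_const_nhds⟩⟩

/-- Two càdlàg functions can be glued at any time. -/
theorem IsCadlag.ite_lt {X : Type*} [TopologicalSpace X] {y z : TimeInterval T → X}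
    (hy : IsCadlag y) (hz : IsCadlag z) (a : TimeInterval T) :
    IsCadlag fun s => if s < a then y s else z s := by
  refine ⟨fun t => ?_, fun t ht => ?_⟩
  · by_cases hta : t < a
    · refine (hy.1 t).congr_of_eventuallyEq ?_ (if_pos hta)
      filter_upwards [mem_nhdsWithin_of_mem_nhds (Iio_mem_nhds hta)] with s hs
      exact if_pos hs
    · exact (hz.1 t).congr (fun s hs => if_neg (not_lt.2 ((not_lt.1 hta).trans hs))) (if_neg hta)
  · by_cases hta : t ≤ a
    · obtain ⟨l, hl⟩ := hy.2 t ht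
      refine ⟨l, hl.congr' ?_⟩
      filter_upwards [self_mem_nhdsWithin] with s hs
      exact (if_pos (lt_of_lt_of_le hs hta)).symm
    · obtain ⟨l, hl⟩ := hz.2 t ht
      refine ⟨l, hl.congr' ?_⟩
      filter_upwards [mem_nhdsWithin_of_mem_nhds (Ioi_mem_nhds (not_le.1 hta))] with s hs
      exact (if_neg (not_lt.2 (le_of_lt hs))).symm

theorem leftValue_eq_of_tendsto {y : TimeInterval T → Vec d} {t : TimeInterval T} (ht : ⊥ < t)
    {l : Vec d} (h : Tendsto y (𝓝[<] t) (𝓝 l)) : leftValue y t = l := by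
  have := nhdsLT_neBot_of_bot_lt ht
  rw [leftValue, if_neg ht.ne']
  exact leftLim_eq_of_tendsto h

variable {Γ : TimeInterval T → Set (Vec d)}

/-- A selection has to exist, since otherwise the left side is empty. -/
theorem tildeMap_bot (h : (cadlagSelections Γ).Nonempty) : tildeMap Γ ⊥ = {0} := by
  have : (fun y => leftValue y ⊥) '' cadlagSelections Γ = {0} := by
    refine (Nonempty.image _ h).subset_singleton_iff.1 ?_
    rintro _ ⟨y, -, rfl⟩
    simp [leftValue]
  rw [tildeMap, this, closure_singleton]

theorem vecMap_of_bot_lt {t : TimeInterval T} (ht : ⊥ < t) :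
    vecMap Γ t = innerLimit (𝓝[<] t) Γ :=
  if_neg ht.ne'

theorem tildeMap_subset_vecMap {t : TimeInterval T} (ht : ⊥ < t) :
    tildeMap Γ t ⊆ vecMap Γ t := by
  rw [vecMap_of_bot_lt ht]
  refine closure_minimal ?_ (isClosed_innerLimit _ _)
  rintro _ ⟨y, ⟨hy, hyΓ⟩, rfl⟩ U hU
  obtain ⟨l, hl⟩ := hy.2 t ht
  dsimp only at hU
  rw [leftValue_eq_of_tendsto ht hl] at hU
  exact (hl.eventually hU).mono fun s hs => ⟨y s, hyΓ s, hs⟩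

/-- It suffices to approximate the left inner limits at positive times by left limits of càdlàg
selections. -/
theorem tildeMap_eq_vecMap (hne : (cadlagSelections Γ).Nonempty)
    (h : ∀ t, ⊥ < t → vecMap Γ t ⊆ tildeMap Γ t) (t : TimeInterval T) :
    tildeMap Γ t = vecMap Γ t := by
  rcases eq_bot_or_bot_lt t with rfl | ht
  · rw [tildeMap_bot hne, vecMap, if_pos rfl]
  · exact (tildeMap_subset_vecMap ht).antisymm (h t ht)

theorem mem_tildeMap_of_tendsto {t : TimeInterval T} (ht : ⊥ < t) {y : TimeInterval T → Vec d}
    (hy : y ∈ cadlagSelections Γ) {x : Vec d} (hx : Tendsto y (𝓝[<] t) (𝓝 x)) :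
    x ∈ tildeMap Γ t :=
  subset_closure ⟨y, hy, leftValue_eq_of_tendsto ht hx⟩

section CadlagMap

theorem IsRightIsc.subset_innerLimit (h : IsRightIsc Γ) (t : TimeInterval T) :
    Γ t ⊆ innerLimit (𝓝[≥] t) Γ := by
  intro x hx U hU
  refine (h _ isOpen_interior t ⟨x, hx, mem_interior_iff_mem_nhds.2 hU⟩).mono fun s hs => ?_
  exact hs.mono (inter_subset_inter_right _ interior_subset)

theorem IsRightOsc.outerLimit_subset (h : IsRightOsc Γ) (t : TimeInterval T) :
    outerLimit (𝓝[≥] t) Γ ⊆ Γ t := by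
  intro x hx
  by_contra hxt
  obtain ⟨p, hp, q, hq, hpq⟩ := eventually_prod_iff.1 (h t x hxt)
  obtain ⟨s, ⟨z, hzΓ, hzq⟩, hs⟩ := ((hx {z | q z} hq).and_eventually hp).exists
  exact hpq hs hzq hzΓ

variable (hΓ : IsCadlagMap Γ) (hne : ∀ t, (Γ t).Nonempty) (hcl : ∀ t, IsClosed (Γ t))
  (hconv : ∀ t, Convex ℝ (Γ t)) (hvec : ∀ t, ⊥ < t → (vecMap Γ t).Nonempty)

include hΓ hne hcl hconv hvec

theorem tendsto_nearestPoint_nhdsLT {t : TimeInterval T} (ht : ⊥ < t) (x : Vec d) :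
    Tendsto (fun s => nearestPoint (Γ s) x) (𝓝[<] t) (𝓝 (nearestPoint (vecMap Γ t) x)) := by
  have hv := hvec t ht
  rw [vecMap_of_bot_lt ht] at hv ⊢
  exact tendsto_nearestPoint hne hcl hconv hv (isClosed_innerLimit _ _) (convex_innerLimit hconv)
    Subset.rfl (hΓ.leftLimits t ht).superset x

theorem nearestPoint_mem_cadlagSelections (x : Vec d) :
    (fun s => nearestPoint (Γ s) x) ∈ cadlagSelections Γ := by
  refine ⟨⟨fun t => ?_, fun t ht =>
    ⟨_, tendsto_nearestPoint_nhdsLT hΓ hne hcl hconv hvec ht x⟩⟩, fun t =>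
    (nearestPoint_spec (hne t) (hcl t) (hconv t) x).1⟩
  exact tendsto_nearestPoint hne hcl hconv (hne t) (hcl t) (hconv t)
    (hΓ.rightIsc.subset_innerLimit t) (hΓ.rightOsc.outerLimit_subset t) x

/-- A point `x` of `vecMap Γ t` is its own nearest point there, so the nearest-point path towards
`x` has left limit `x` at `t`. -/
theorem IsCadlagMap.tildeMap_eq_vecMap (t : TimeInterval T) : tildeMap Γ t = vecMap Γ t := by
  refine CadlagSelections.tildeMap_eq_vecMap
    ⟨_, nearestPoint_mem_cadlagSelections hΓ hne hcl hconv hvec 0⟩ (fun t ht x hx => ?_) t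
  refine mem_tildeMap_of_tendsto ht
    (nearestPoint_mem_cadlagSelections hΓ hne hcl hconv hvec x) ?_
  have h := tendsto_nearestPoint_nhdsLT hΓ hne hcl hconv hvec ht x
  have hs := nearestPoint_spec (hvec t ht)
    (vecMap_of_bot_lt (Γ := Γ) ht ▸ isClosed_innerLimit _ _)
    (vecMap_of_bot_lt (Γ := Γ) ht ▸ convex_innerLimit hconv) x
  rwa [← hs.2.2 x hx (by simp)] at h

end CadlagMap

/-! ### Solid mappings -/

section Solid

variable (hS : IsSolidOn Γ univ) (hV : IsSolidOn (vecMap Γ) (Ioi ⊥))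

include hS

theorem exists_Ioo_of_mem_interior_vecMap {t : TimeInterval T} (ht : ⊥ < t) {x : Vec d}
    (hx : x ∈ interior (vecMap Γ t)) : ∃ q < t, ∀ s ∈ Ioo q t, x ∈ Γ s := by
  rw [vecMap_of_bot_lt ht] at hx
  obtain ⟨r, hr, h⟩ :=
    exists_ball_subset_of_mem_interior_innerLimit (fun s => (hS s trivial).1) hx
  obtain ⟨q, hq, hqs⟩ := (mem_nhdsLT_iff_exists_Ioo_subset' ht).1 h
  exact ⟨q, hq, fun s hs => hqs hs (Metric.mem_ball_self hr)⟩

theorem IsRightIsc.exists_eventually_mem (h : IsRightIsc Γ) (t : TimeInterval T) :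
    ∃ x, ∀ᶠ s in 𝓝[≥] t, x ∈ Γ s := by
  obtain ⟨x, hx⟩ := (hS t trivial).2
  obtain ⟨r, hr, h⟩ := exists_ball_subset_of_mem_interior_innerLimit
    (fun s => (hS s trivial).1) (interior_mono (h.subset_innerLimit t) hx)
  exact ⟨x, h.mono fun s hs => hs (Metric.mem_ball_self hr)⟩

include hV

/-- A solid right-inner semicontinuous mapping with solid left inner limits has piecewise constant
selections. -/
theorem IsRightIsc.nonempty_cadlagSelections (h : IsRightIsc Γ) :
    (cadlagSelections Γ).Nonempty := by
  -- With `c` the supremum of `A`, constants from the solid left inner limit fill the gap up to `c`,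
  -- and right-inner semicontinuity carries a constant past `c` unless `c` is the last time.
  set A : Set (TimeInterval T) := {t | ∃ y : TimeInterval T → Vec d, IsCadlag y ∧
    ∀ s ≤ t, y s ∈ Γ s} with hA
  obtain ⟨c, hc⟩ : ∃ c, IsLUB A c := ⟨_, isLUB_sSup A⟩
  obtain ⟨y, hy, hyc⟩ : ∃ y : TimeInterval T → Vec d, IsCadlag y ∧ ∀ s < c, y s ∈ Γ s := by
    rcases eq_bot_or_bot_lt c with rfl | hc0
    · exact ⟨_, isCadlag_const 0, fun s hs => absurd hs not_lt_bot⟩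
    obtain ⟨x, hx⟩ := (hV c hc0).2
    obtain ⟨q, hqc, hq⟩ := exists_Ioo_of_mem_interior_vecMap hS hc0 hx
    obtain ⟨a, ⟨y, hy, hya⟩, hqa, -⟩ := hc.exists_between hqc
    refine ⟨_, hy.ite_lt (isCadlag_const x) a, fun s hs => ?_⟩
    split_ifs with hsa
    · exact hya s hsa.le
    · exact hq s ⟨hqa.trans_le (not_lt.1 hsa), hs⟩
  obtain ⟨x, hx⟩ := h.exists_eventually_mem hS c
  have hz := hy.ite_lt (isCadlag_const x) c
  have hmax : ∀ t, t ≤ c := by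
    intro t
    by_contra! hct
    obtain ⟨u, hcu, hu⟩ := (mem_nhdsGE_iff_exists_Ico_subset' hct).1 hx
    obtain ⟨w, hcw, hwu⟩ := exists_between (mem_Ioi.1 hcu)
    have hwA : w ∈ A := ⟨_, hz, fun s hs => ?_⟩
    · exact (hc.1 hwA).not_gt hcw
    split_ifs with hsc
    · exact hyc s hsc
    · exact hu ⟨not_lt.1 hsc, hs.trans_lt hwu⟩
  refine ⟨_, hz, fun s => ?_⟩
  split_ifs with hsc
  · exact hyc s hsc
  · rw [(hmax s).antisymm (not_lt.1 hsc)]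
    exact hx.self_of_nhdsWithin self_mem_Ici

theorem IsSolidOn.tildeMap_eq_vecMap (hne : (cadlagSelections Γ).Nonempty) (t : TimeInterval T) :
    tildeMap Γ t = vecMap Γ t := by
  refine CadlagSelections.tildeMap_eq_vecMap hne (fun t ht => ?_) t
  have hint : interior (vecMap Γ t) ⊆ tildeMap Γ t := by
    intro x hx
    obtain ⟨q, hqt, hq⟩ := exists_Ioo_of_mem_interior_vecMap hS ht hx
    obtain ⟨a, hqa, hat⟩ := exists_between hqt
    obtain ⟨y, hy, hyΓ⟩ := hne
    -- The selection `y` is overwritten by the constant `x` on `[a, t)` only.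
    refine mem_tildeMap_of_tendsto ht
      (y := fun s => if s < a then y s else if s < t then x else y s)
      ⟨hy.ite_lt ((isCadlag_const x).ite_lt hy t) a, fun s => ?_⟩ ?_
    · dsimp only
      split_ifs with h1 h2
      · exact hyΓ s
      · exact hq s ⟨hqa.trans_le (not_lt.1 h1), h2⟩
      · exact hyΓ s
    · refine tendsto_const_nhds.congr' ?_
      filter_upwards [Ioo_mem_nhdsLT hat] with s hs
      rw [if_neg hs.1.not_gt, if_pos hs.2]
  have := (hV t ht).1.closure_interior_eq_closure_of_nonempty_interior (hV t ht).2
  exact (subset_closure.trans this.superset).trans (closure_minimal hint isClosed_closure)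

end Solid

end Paths

end CadlagSelections

namespace CadlagSelections

/-! ### Convexity and measurability of the domain mapping -/

section ClosureDom

variable {Ξ : Type*} {d : ℕ} {h : Ξ → Vec d → EReal}

theorem lt_top_iff_exists_mem_epi {ξ : Ξ} {x : Vec d} : h ξ x < ⊤ ↔ ∃ α, (x, α) ∈ epi h ξ := by
  constructor
  · intro hx
    obtain ⟨α, hα, -⟩ := EReal.lt_iff_exists_real_btwn.1 hx
    exact ⟨α, hα.le⟩
  · rintro ⟨α, hα⟩
    exact lt_of_le_of_lt hα (EReal.coe_lt_top α)

theorem setOf_lt_top_eq_image_epi (ξ : Ξ) : {x | h ξ x < ⊤} = Prod.fst '' epi h ξ := by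
  ext x
  simp [lt_top_iff_exists_mem_epi]

theorem convex_closureDom {ξ : Ξ} (hconv : Convex ℝ (epi h ξ)) : Convex ℝ (closureDom h ξ) := by
  rw [closureDom, setOf_lt_top_eq_image_epi]
  exact (hconv.linear_image (LinearMap.fst ℝ (Vec d) ℝ)).closure

/-- An open `O` meets the closure of the domain iff it meets the domain, that is, iff the epigraph
meets `O × ℝ`. -/
theorem isMeasurableMap_closureDom {𝒜 : MeasurableSpace Ξ} (hm : IsMeasurableMap 𝒜 (epi h)) :
    IsMeasurableMap 𝒜 (closureDom h) := by
  intro O hO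
  convert hm (O ×ˢ univ) (hO.prod isOpen_univ) using 1
  ext ξ
  simp only [mem_ofPred_eq]
  rw [closureDom, closure_inter_open_nonempty_iff hO, setOf_lt_top_eq_image_epi]
  constructor
  · rintro ⟨_, ⟨p, hp, rfl⟩, hpO⟩
    exact ⟨p, hp, hpO, trivial⟩
  · rintro ⟨p, hp, hpO, -⟩
    exact ⟨p.1, mem_image_of_mem _ hp, hpO⟩

/-- The points at which a closed-valued measurable mapping contains a given open set. -/
theorem IsMeasurableMap.measurableSet_subset {𝒜 : MeasurableSpace Ξ} {X : Type*}
    [PseudoMetricSpace X] [TopologicalSpace.SeparableSpace X] {Γ : Ξ → Set X}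
    (hm : IsMeasurableMap 𝒜 Γ) (hcl : ∀ ξ, IsClosed (Γ ξ)) {U : Set X} (hU : IsOpen U) :
    MeasurableSet[𝒜] {ξ | U ⊆ Γ ξ} := by
  obtain ⟨D, hDc, hD⟩ := TopologicalSpace.exists_countable_dense X
  -- Closedness lets inclusion be tested on a countable dense part of `U`, and membership by small
  -- balls.
  have key : {ξ | U ⊆ Γ ξ} =
      ⋂ z ∈ D ∩ U, ⋂ n : ℕ, {ξ | (Γ ξ ∩ Metric.ball z (1 / (n + 1))).Nonempty} := by
    ext ξ
    simp only [mem_ofPred_eq, mem_iInter]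
    constructor
    · exact fun h z hz n => ⟨z, h hz.2, Metric.mem_ball_self Nat.one_div_pos_of_nat⟩
    · intro h
      have hDU : U ∩ D ⊆ Γ ξ := fun z hz => by
        rw [← (hcl ξ).closure_eq, Metric.mem_closure_iff]
        intro ε hε
        obtain ⟨n, hn⟩ := exists_nat_one_div_lt hε
        obtain ⟨w, hw, hwz⟩ := h z hz.symm n
        exact ⟨w, hw, (dist_comm z w ▸ Metric.mem_ball.1 hwz).trans hn⟩
      exact (hD.open_subset_closure_inter hU).trans (closure_minimal hDU (hcl ξ))
  rw [key]
  exact .biInter (hDc.mono inter_subset_left) fun z _ => .iInter fun n => hm _ Metric.isOpen_ball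

end ClosureDom

/-! ### Predictability of the left inner limits -/

section Predictable

variable {Ω : Type*} {mΩ : MeasurableSpace Ω} {T : ℝ≥0∞} {d : ℕ}
  {𝓕 : Filtration (TimeInterval T) mΩ} {P : Measure Ω} [IsFiniteMeasure P]

/-- The times immediately before which a path stays in an optional set form a predictable set. -/
theorem measurableSet_predictable_eventually_nhdsLT (h𝓕 : UsualConditions P 𝓕)
    {G : Set (TimeInterval T × Ω)} (hG : MeasurableSet[optionalSigmaAlgebra 𝓕] G) :
    MeasurableSet[𝓕.predictable]
      {p : TimeInterval T × Ω | ⊥ < p.1 ∧ ∀ᶠ s in 𝓝[<] p.1, (s, p.2) ∈ G} := by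
  obtain ⟨D, hDc, hD⟩ := TopologicalSpace.exists_countable_dense (TimeInterval T)
  have key : {p : TimeInterval T × Ω | ⊥ < p.1 ∧ ∀ᶠ s in 𝓝[<] p.1, (s, p.2) ∈ G} =
      ⋃ q ∈ D, {p | q < p.1 ∧ ∀ s ∈ Ioo q p.1, (s, p.2) ∈ G} := by
    ext ⟨t, ω⟩
    simp only [mem_ofPred_eq, mem_iUnion, exists_prop]
    constructor
    · rintro ⟨ht, h⟩
      obtain ⟨a, hat, ha⟩ := (mem_nhdsLT_iff_exists_Ioo_subset' ht).1 h
      obtain ⟨q, hqD, hq⟩ := hD.exists_mem_open isOpen_Ioo (nonempty_Ioo.2 hat)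
      exact ⟨q, hqD, hq.2, fun s hs => ha ⟨hq.1.trans hs.1, hs.2⟩⟩
    · rintro ⟨q, -, hqt, hq⟩
      exact ⟨bot_le.trans_lt hqt, mem_of_superset (Ioo_mem_nhdsLT hqt) hq⟩
  rw [key]
  exact .biUnion hDc fun q _ => measurableSet_predictable_forall_mem_Ioo 𝓕 h𝓕 hG q

/-- A criterion for the left inner limits of a random mapping to be predictable. -/
theorem isMeasurableMap_predictable_vecMap (h𝓕 : UsualConditions P 𝓕)
    {S : Ω → TimeInterval T → Set (Vec d)}
    (h : ∀ O : Set (Vec d), IsOpen O → ∃ (I : Set (Set (Vec d)))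
      (G : Set (Vec d) → Set (TimeInterval T × Ω)), I.Countable ∧
      (∀ B ∈ I, MeasurableSet[optionalSigmaAlgebra 𝓕] (G B)) ∧
      ∀ ω t, ⊥ < t → ((vecMap (S ω) t ∩ O).Nonempty ↔
        ∃ B ∈ I, ∀ᶠ s in 𝓝[<] t, (s, ω) ∈ G B)) :
    IsMeasurableMap 𝓕.predictable (fun p => vecMap (S p.2) p.1) := by
  intro O hO
  obtain ⟨I, G, hI, hG, hIG⟩ := h O hO
  have key : {p : TimeInterval T × Ω | (vecMap (S p.2) p.1 ∩ O).Nonempty} =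
      {⊥} ×ˢ {_ω | (0 : Vec d) ∈ O} ∪
        ⋃ B ∈ I, {p | ⊥ < p.1 ∧ ∀ᶠ s in 𝓝[<] p.1, (s, p.2) ∈ G B} := by
    ext ⟨t, ω⟩
    rcases eq_bot_or_bot_lt t with rfl | ht
    · simp [vecMap]
    · simp [hIG ω t ht, ht, ht.ne']
  rw [key]
  exact (measurableSet_predictable_singleton_bot_prod (.const _)).union
    (.biUnion hI fun B hB => measurableSet_predictable_eventually_nhdsLT h𝓕 (hG B hB))

/-- Countably many balls with closure in a given open set `O` suffice to refine any
neighbourhood of a point of `O`. -/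
theorem exists_countable_balls {X : Type*} [PseudoMetricSpace X]
    [TopologicalSpace.SeparableSpace X] {O : Set X} (hO : IsOpen O) :
    ∃ I : Set (Set X), I.Countable ∧
      (∀ B ∈ I, ∃ x r, B = Metric.ball x r ∧ Metric.closedBall x r ⊆ O) ∧
      ∀ x ∈ O, ∀ U ∈ 𝓝 x, ∃ B ∈ I, x ∈ B ∧ B ⊆ U := by
  obtain ⟨D, hDc, hD⟩ := TopologicalSpace.exists_countable_dense X
  refine ⟨{B | B ∈ (fun p : X × ℕ => Metric.ball p.1 (1 / ((p.2 : ℝ) + 1))) '' (D ×ˢ univ) ∧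
    ∃ x r, B = Metric.ball x r ∧ Metric.closedBall x r ⊆ O},
    ((hDc.prod countable_univ).image _).mono fun B hB => hB.1, fun B hB => hB.2,
    fun x hx U hU => ?_⟩
  obtain ⟨ε, hε, hεU⟩ := Metric.mem_nhds_iff.1 (inter_mem hU (hO.mem_nhds hx))
  obtain ⟨n, hn⟩ := exists_nat_one_div_lt (half_pos hε)
  obtain ⟨z, hz, hzx⟩ := hD.exists_dist_lt x (Nat.one_div_pos_of_nat (n := n) (α := ℝ))
  have hsub : Metric.closedBall z (1 / ((n : ℝ) + 1)) ⊆ U ∩ O := fun y hy => hεU <| by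
    have := dist_triangle y z x
    rw [dist_comm z x] at this
    exact Metric.mem_ball.2 (by linarith [Metric.mem_closedBall.1 hy])
  exact ⟨_, ⟨⟨(z, n), ⟨hz, trivial⟩, rfl⟩, z, _, rfl, hsub.trans inter_subset_right⟩, hzx,
    (Metric.ball_subset_closedBall.trans hsub).trans inter_subset_left⟩

variable {S : Ω → TimeInterval T → Set (Vec d)}

/-- Left limits of an optional mapping are predictable. -/
theorem isMeasurableMap_vecMap_of_hasLeftLimits (h𝓕 : UsualConditions P 𝓕)
    (hm : IsMeasurableMap (optionalSigmaAlgebra 𝓕) (fun p => S p.2 p.1))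
    (hS : ∀ ω, HasLeftLimits (S ω)) :
    IsMeasurableMap 𝓕.predictable (fun p => vecMap (S p.2) p.1) := by
  refine isMeasurableMap_predictable_vecMap h𝓕 fun O hO => ?_
  obtain ⟨I, hI, hIball, hIsub⟩ := exists_countable_balls hO
  refine ⟨I, fun B => {p | (S p.2 p.1 ∩ B).Nonempty}, hI, fun B hB => ?_, fun ω t ht => ?_⟩
  · obtain ⟨x, r, rfl, -⟩ := hIball B hB
    exact hm _ Metric.isOpen_ball
  rw [vecMap_of_bot_lt ht]
  constructor
  · rintro ⟨x, hx, hxO⟩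
    obtain ⟨B, hB, hxB, -⟩ := hIsub x hxO univ univ_mem
    obtain ⟨z, r, rfl, -⟩ := hIball B hB
    exact ⟨_, hB, hx _ (Metric.isOpen_ball.mem_nhds hxB)⟩
  · rintro ⟨B, hB, h⟩
    obtain ⟨z, r, rfl, hzO⟩ := hIball B hB
    have := nhdsLT_neBot_of_bot_lt ht
    -- Compactness gives a point of the outer limit in the closed ball, inside `O`; by `hS` it is in
    -- the inner limit.
    obtain ⟨x, hx, hxK⟩ := nonempty_outerLimit_inter (isCompact_closedBall z r)
      (h.mono fun s hs => hs.mono (inter_subset_inter_right _ Metric.ball_subset_closedBall)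
        : ∀ᶠ s in 𝓝[<] t, (S ω s ∩ Metric.closedBall z r).Nonempty).frequently
    exact ⟨x, (hS ω t ht).superset hx, hzO hxK⟩

/-- Solid left inner limits of an optional solid mapping are predictable. -/
theorem isMeasurableMap_vecMap_of_isSolidOn (h𝓕 : UsualConditions P 𝓕)
    (hm : IsMeasurableMap (optionalSigmaAlgebra 𝓕) (fun p => S p.2 p.1))
    (hcl : ∀ ω t, IsClosed (S ω t)) (hS : ∀ ω, IsSolidOn (S ω) univ)
    (hV : ∀ ω, IsSolidOn (vecMap (S ω)) (Ioi ⊥)) :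
    IsMeasurableMap 𝓕.predictable (fun p => vecMap (S p.2) p.1) := by
  refine isMeasurableMap_predictable_vecMap h𝓕 fun O hO => ?_
  obtain ⟨I, hI, hIball, hIsub⟩ := exists_countable_balls hO
  -- An empty ball would satisfy the inclusion trivially.
  refine ⟨{B ∈ I | B.Nonempty}, fun B => {p | B ⊆ S p.2 p.1}, hI.mono fun B hB => hB.1,
    fun B hB => ?_, fun ω t ht => ?_⟩
  · obtain ⟨x, r, rfl, -⟩ := hIball B hB.1
    exact hm.measurableSet_subset (fun p => hcl p.2 p.1) Metric.isOpen_ball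
  constructor
  · intro h
    -- By solidity, an open set meeting the limit meets its interior.
    obtain ⟨x, hx, hxO⟩ : (interior (vecMap (S ω) t) ∩ O).Nonempty := by
      rw [← closure_inter_open_nonempty_iff hO,
        (hV ω t ht).1.closure_interior_eq_closure_of_nonempty_interior (hV ω t ht).2]
      exact h.mono (inter_subset_inter_left _ subset_closure)
    rw [vecMap_of_bot_lt ht] at hx
    obtain ⟨r, hr, hrS⟩ :=
      exists_ball_subset_of_mem_interior_innerLimit (fun s => (hS ω s trivial).1) hx
    obtain ⟨B, hB, hxB, hBr⟩ := hIsub x hxO _ (Metric.ball_mem_nhds x hr)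
    exact ⟨B, ⟨hB, x, hxB⟩, hrS.mono fun s hs => hBr.trans hs⟩
  · rintro ⟨B, ⟨hB, x, hx⟩, h⟩
    obtain ⟨z, r, rfl, hzO⟩ := hIball B hB
    rw [vecMap_of_bot_lt ht]
    exact ⟨x, fun U hU => h.mono fun s hs => ⟨x, hs hx, mem_of_mem_nhds hU⟩,
      hzO (Metric.ball_subset_closedBall hx)⟩

end Predictable

end CadlagSelections

theorem mainTheorem12 {Ω : Type*} {mΩ : MeasurableSpace Ω}
    (P : Measure Ω) [IsProbabilityMeasure P]
    (T : ℝ≥0∞) (hT : 0 < T)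
    (𝓕 : Filtration (CadlagSelections.TimeInterval T) mΩ)
    (h𝓕 : CadlagSelections.UsualConditions P 𝓕)
    (d : ℕ)
    (h : CadlagSelections.TimeInterval T × Ω → CadlagSelections.Vec d → EReal)
    (hh : CadlagSelections.IsConvexNormalIntegrand
      (CadlagSelections.optionalSigmaAlgebra 𝓕) h)
    (S : Ω → CadlagSelections.TimeInterval T → Set (CadlagSelections.Vec d))
    (hS : ∀ ω t, S ω t = CadlagSelections.closureDom h (t, ω))
    (hcond :
      (∀ ω, CadlagSelections.IsCadlagMap (S ω) ∧ (∀ t, (S ω t).Nonempty) ∧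
        ∀ t, ⊥ < t → (CadlagSelections.vecMap (S ω) t).Nonempty) ∨
      (∀ ω, CadlagSelections.IsSolidOn (S ω) Set.univ ∧
        CadlagSelections.IsSolidOn (CadlagSelections.vecMap (S ω)) (Set.Ioi ⊥) ∧
        (CadlagSelections.IsRightIsc (S ω) ∨
          (CadlagSelections.cadlagSelections (S ω)).Nonempty))) :
    (∀ ω t, CadlagSelections.tildeMap (S ω) t = CadlagSelections.vecMap (S ω) t) ∧
      CadlagSelections.IsMeasurableMap 𝓕.predictable
        (fun p => CadlagSelections.tildeMap (S p.2) p.1) := by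
  have hSeq : (fun p : CadlagSelections.TimeInterval T × Ω => S p.2 p.1) =
      CadlagSelections.closureDom h :=
    funext fun p => hS p.2 p.1
  have hcl : ∀ ω t, IsClosed (S ω t) := fun ω t => hS ω t ▸ isClosed_closure
  have hm : CadlagSelections.IsMeasurableMap (CadlagSelections.optionalSigmaAlgebra 𝓕)
      (fun p => S p.2 p.1) :=
    hSeq ▸ CadlagSelections.isMeasurableMap_closureDom hh.measurable
  rcases hcond with hc | hs
  · have hconv : ∀ ω t, Convex ℝ (S ω t) := fun ω t =>
      hS ω t ▸ CadlagSelections.convex_closureDom (hh.convex (t, ω))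
    have heq : ∀ ω t, CadlagSelections.tildeMap (S ω) t = CadlagSelections.vecMap (S ω) t :=
      fun ω => (hc ω).1.tildeMap_eq_vecMap (hc ω).2.1 (hcl ω) (hconv ω) (hc ω).2.2
    refine ⟨heq, ?_⟩
    simp only [heq]
    exact CadlagSelections.isMeasurableMap_vecMap_of_hasLeftLimits h𝓕 hm
      fun ω => (hc ω).1.leftLimits
  · have heq : ∀ ω t, CadlagSelections.tildeMap (S ω) t = CadlagSelections.vecMap (S ω) t :=
      fun ω => (hs ω).1.tildeMap_eq_vecMap (hs ω).2.1 <|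
        (hs ω).2.2.elim (fun hr => hr.nonempty_cadlagSelections (hs ω).1 (hs ω).2.1) id
    refine ⟨heq, ?_⟩
    simp only [heq]
    exact CadlagSelections.isMeasurableMap_vecMap_of_isSolidOn h𝓕 hm hcl
      (fun ω => (hs ω).1) fun ω => (hs ω).2.1
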